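/- For a compact Hausdorff space $X$ let $C(X,[0,1])$ be the set of continuous functions $X\to[0,1]$. A $\cdot$-measure on $X$ is a functional $\mu: C(X,[0,1])\to[0,1]$ such that (1) $\mu(1_X)=1$, where $c_X$ denotes the constant function with value $c$; (2) $\mu(\lambda_X\cdot\varphi)=\lambda\cdot\mu(\varphi)$ for all $\lambda\in[0,1]$ and $\varphi\in C(X,[0,1])$; (3) $\mu(\psi\vee\varphi)=\mu(\psi)\vee\mu(\varphi)$ for all $\psi,\varphi\in C(X,[0,1])$, where $\vee$ denotes the (pointwise) maximum. Let $A^{\cdot}X$ be the set of all $\cdot$-measures on $X$, with the topology of a subspace of the product $[0,1]^{C(X,[0,1])}$; it is again a compact Hausdorff space, so $A^{\cdot}(A^{\cdot}X)$ is defined. For each $\varphi\in C(X,[0,1])$ let $\mathrm{pr}_\varphi: A^{\cdot}X\to[0,1]$, $\mathrm{pr}_\varphi(\mu)=\mu(\varphi)$, be the coordinate projection. The max-$\cdot$ barycenter map $\beta^{\cdot}_{A^{\cdot}X}: A^{\cdot}(A^{\cdot}X)\to A^{\cdot}X$ is the (well-defined) map given by $\beta^{\cdot}_{A^{\cdot}X}(M)(\varphi)=M(\mathrm{pr}_\varphi)$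 for all $M\in A^{\cdot}(A^{\cdot}X)$ and $\varphi\in C(X,[0,1])$. **Theorem.** For every compact Hausdorff space $X$, the max-$\cdot$ barycenter map $\beta^{\cdot}_{A^{\cdot}X}: A^{\cdot}(A^{\cdot}X)\to A^{\cdot}X$ is open. -/

import Mathlib

open scoped unitInterval

/-- The set `A^·(X)` of `·`-measures on `X`: functionals `μ : C(X,[0,1]) → [0,1]` that are normed,
homogeneous under multiplication by constants of `[0,1]`, and preserve the (pointwise) maximum.
Here `1`, `*`, `⊔` on `C(X, I)` are pointwise. Coerced to a type, it carries the subspace topology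
of the product topology on `[0,1]^{C(X,[0,1])}`. -/
def dotMeasures (X : Type*) [TopologicalSpace X] : Set (C(X, I) → I) :=
  {μ | μ (ContinuousMap.const X 1) = 1 ∧
    (∀ (c : I) (φ : C(X, I)), μ (ContinuousMap.const X c * φ) = c * μ φ) ∧
    ∀ φ ψ : C(X, I), μ (φ ⊔ ψ) = μ φ ⊔ μ ψ}

/-- The restriction to `K ⊆ [0,1]^T` of the projection onto the coordinate `t`. -/
def coordOn {T : Type*} (K : Set (T → I)) (t : T) : C(K, I) where
  toFun x := (x : T → I) t
  continuous_toFun := (continuous_apply t).comp continuous_subtype_val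

/-- The barycenter of a `·`-measure `μ` on `K ⊆ [0,1]^T`, as a point of `[0,1]^T`:
its coordinate at `t` is the value of `μ` at the projection `K → [0,1]` onto that coordinate. -/
def dotBarycenter {T : Type*} (K : Set (T → I)) (μ : dotMeasures K) : T → I :=
  fun t => (μ : C(K, I) → I) (coordOn K t)

/-- For `K = A^·(X) ⊆ [0,1]^{C(X,[0,1])}` barycenters lie in `K`. -/
theorem dotBarycenter_mem (X : Type*) [TopologicalSpace X] (M : dotMeasures (dotMeasures X)) :
    dotBarycenter (dotMeasures X) M ∈ dotMeasures X := by
  obtain ⟨M, h1, h2, h3⟩ := M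
  refine ⟨?_, fun c φ => ?_, fun φ ψ => ?_⟩
  · refine Eq.trans (congrArg M (ContinuousMap.ext fun μ => ?_)) h1
    exact μ.2.1
  · refine Eq.trans (congrArg M (ContinuousMap.ext fun μ => ?_)) (h2 c _)
    exact μ.2.2.1 c φ
  · refine Eq.trans (congrArg M (ContinuousMap.ext fun μ => ?_)) (h3 _ _)
    exact μ.2.2.2 φ ψ

/-- The max-`·` barycenter map `β^·_{A^·X} : A^·(A^·X) → A^·X`. -/
def dotBarycenterMap (X : Type*) [TopologicalSpace X] :
    dotMeasures (dotMeasures X) → dotMeasures X :=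
  fun M => ⟨dotBarycenter (dotMeasures X) M, dotBarycenter_mem X M⟩

open scoped NNReal
open Topology

/-! Openness at `M`, with barycenter `ν`, follows once every neighborhood of `M` contains the value
at `ν` of some continuous section of the barycenter map: nearby points are then barycenters of
nearby values of the section. Measures are extended homogeneously to nonnegative functions, so that
rescaling is free. Continuous weights `h j` with maximum `1` give the section sending `ν'` to the
maximum of the Dirac measures at the normalized functionals `ν' (h j * ·)`, each scaled by `ν' (h
j)`. To get close to `M`, `exists_combine_approx` cuts `M` by a max-partition of unity and replaces
each piece by a Dirac measure at its own barycenter. This writes `ν` as a maximum of functionals `ρ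
j`, which need not have the form `ν (h j * ·)`. The crux, `IsMaxTimes.exists_weights`, shows that
they are limits of such: a max-preserving functional is a supremum of weighted point evaluations,
and weights can be built from finitely many test functions. -/

instance ContinuousMap.instOrderBotNNReal {X : Type*} [TopologicalSpace X] :
    OrderBot C(X, ℝ≥0) where
  bot := 0
  bot_le _ _ := zero_le

theorem ContinuousMap.finset_sup_apply {X ι : Type*} [TopologicalSpace X] (s : Finset ι)
    (f : ι → C(X, ℝ≥0)) (x : X) : s.sup f x = s.sup fun i => f i x :=
  Finset.apply_sup_eq_sup_comp (fun g : C(X, ℝ≥0) => g x) (fun _ _ => rfl) rfl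

/-- Positively homogeneous functionals on nonnegative continuous functions that preserve binary
suprema. -/
structure IsMaxTimes {X : Type*} [TopologicalSpace X] (L : C(X, ℝ≥0) → ℝ≥0) : Prop where
  map_smul : ∀ (c : ℝ≥0) (φ : C(X, ℝ≥0)), L (c • φ) = c * L φ
  map_sup : ∀ φ ψ : C(X, ℝ≥0), L (φ ⊔ ψ) = L φ ⊔ L ψ

/-! ### Max-preserving functionals: density points and approximation by weights. -/

namespace IsMaxTimes

variable {X : Type*} [TopologicalSpace X] {L L' : C(X, ℝ≥0) → ℝ≥0}

theorem map_zero (hL : IsMaxTimes L) : L 0 = 0 := by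
  simpa using hL.map_smul 0 0

theorem mono (hL : IsMaxTimes L) {φ ψ : C(X, ℝ≥0)} (h : ∀ x, φ x ≤ ψ x) : L φ ≤ L ψ := by
  have h1 : φ ⊔ ψ = ψ := sup_eq_right.2 h
  rw [← h1, hL.map_sup]
  exact le_sup_left

theorem map_finset_sup (hL : IsMaxTimes L) {ι : Type*} (s : Finset ι) (f : ι → C(X, ℝ≥0)) :
    L (s.sup f) = s.sup fun i => L (f i) :=
  Finset.apply_sup_eq_sup_comp L hL.map_sup hL.map_zero

theorem map_le_mul (hL : IsMaxTimes L) {φ ψ : C(X, ℝ≥0)} {c : ℝ≥0}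
    (h : ∀ x, φ x ≤ c * ψ x) : L φ ≤ c * L ψ := by
  rw [← hL.map_smul]
  exact hL.mono h

theorem mul_le_map (hL : IsMaxTimes L) {φ ψ : C(X, ℝ≥0)} {c : ℝ≥0}
    (h : ∀ x, c * φ x ≤ ψ x) : c * L φ ≤ L ψ := by
  rw [← hL.map_smul]
  exact hL.mono h

theorem comp_mul (hL : IsMaxTimes L) (h : C(X, ℝ≥0)) : IsMaxTimes fun φ => L (h * φ) where
  map_smul c φ := by rw [mul_smul_comm, hL.map_smul]
  map_sup φ ψ := by
    rw [← hL.map_sup]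
    congr 1
    ext x
    simp [mul_max_of_nonneg]

/-- The value of a functional at `φ` is attained at a point `s` of its density. -/
theorem exists_support_point [CompactSpace X] (hL : IsMaxTimes L) {φ : C(X, ℝ≥0)}
    (hφ : L φ ≠ 0) : ∃ s, ∀ ψ : C(X, ℝ≥0), L φ * ψ s ≤ L ψ * φ s := by
  -- Otherwise each point has a function that exceeds `φ` there but has smaller `L`-value; by
  -- compactness a finite maximum of these dominates `φ`, which contradicts monotonicity.
  by_contra! H
  have H' : ∀ s, ∃ ψ : C(X, ℝ≥0), φ s < ψ s ∧ L ψ < L φ := by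
    intro s
    obtain ⟨ψ, hψ⟩ := H s
    have hψs : 0 < ψ s := by
      by_contra! h
      simp [nonpos_iff_eq_zero.1 h] at hψ
    have hlt : ∃ c : ℝ≥0, φ s < c * ψ s ∧ c * L ψ < L φ := by
      rcases eq_or_ne (L ψ) 0 with h0 | h0
      · refine ⟨(φ s + 1) / ψ s, ?_, by simpa [h0] using pos_iff_ne_zero.2 hφ⟩
        rw [div_mul_cancel₀ _ hψs.ne']
        exact lt_add_one _
      · have hp := pos_iff_ne_zero.2 h0
        obtain ⟨c, h1, h2⟩ := exists_between (show φ s / ψ s < L φ / L ψ by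
          rw [div_lt_div_iff₀ hψs hp, mul_comm]; exact hψ)
        exact ⟨c, (div_lt_iff₀ hψs).1 h1, (lt_div_iff₀ hp).1 h2⟩
    obtain ⟨c, h1, h2⟩ := hlt
    exact ⟨c • ψ, h1, by rwa [hL.map_smul]⟩
  choose ψ h1 h2 using H'
  obtain ⟨t, ht⟩ := CompactSpace.elim_nhds_subcover (fun s => {x | φ x < ψ s x})
    fun s => (isOpen_lt φ.continuous (ψ s).continuous).mem_nhds (h1 s)
  have hle : L φ ≤ L (t.sup ψ) := hL.mono fun x => by
    have hx : x ∈ ⋃ s ∈ t, {x | φ x < ψ s x} := ht ▸ Set.mem_univ x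
    simp only [Set.mem_iUnion] at hx
    obtain ⟨s, hs, hx⟩ := hx
    rw [ContinuousMap.finset_sup_apply]
    exact (le_of_lt hx).trans (Finset.le_sup (f := fun i => ψ i x) hs)
  rw [hL.map_finset_sup] at hle
  exact absurd hle (not_le.2 ((Finset.sup_lt_iff (pos_iff_ne_zero.2 hφ)).2 fun s _ => h2 s))

/-- At a density point `s` of `L'` for `φ`, a suitable `v` nearly realizes the density of `L` at
`s`, so a lower bound for `h` at that one point suffices. Since `v` is chosen before `w` and `h`,
many tests can be imposed on one weight. -/
theorem exists_upper_test [CompactSpace X] (hL : IsMaxTimes L) (hL' : IsMaxTimes L')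
    (hle : ∀ φ, L' φ ≤ L φ) (φ : C(X, ℝ≥0)) {δ : ℝ≥0} (hδ : 0 < δ) :
    ∃ v : C(X, ℝ≥0), L v ≤ 1 ∧ ∀ w h : C(X, ℝ≥0), L' w ≤ 1 →
      (∀ s, h s = 1 ∨ v s ≤ h s * w s) → L' φ ≤ L (h * φ) + δ := by
  rcases eq_or_ne (L' φ) 0 with h0 | h0
  · exact ⟨0, by simp [hL.map_zero], fun w h _ _ => by simp [h0]⟩
  obtain ⟨s, hs⟩ := hL'.exists_support_point h0
  have ht := pos_iff_ne_zero.2 h0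
  have hφs : 0 < φ s := by
    by_contra! h
    have := hs 1
    simp [nonpos_iff_eq_zero.1 h] at this
    exact h0 this
  -- The supremum `f` of `S` is the density of `L` at `s`; the density `L' φ / φ s` of `L'` lies
  -- below it.
  set S : Set ℝ≥0 := {c | ∀ ψ : C(X, ℝ≥0), c * ψ s ≤ L ψ} with hS
  have hbdd : BddAbove S := ⟨L 1, fun c hc => by simpa using hc 1⟩
  have hmem : L' φ / φ s ∈ S := fun ψ => by
    rw [div_mul_eq_mul_div, div_le_iff₀ hφs]
    exact (hs ψ).trans (by gcongr; exact hle ψ)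
  set f := sSup S with hf
  have hfS : ∀ ψ : C(X, ℝ≥0), f * ψ s ≤ L ψ := fun ψ => by
    rcases eq_or_ne (ψ s) 0 with h | h
    · simp [h]
    · have hp := pos_iff_ne_zero.2 h
      rw [← le_div_iff₀ hp]
      exact csSup_le ⟨_, hmem⟩ fun c hc => (le_div_iff₀ hp).2 (hc ψ)
  have hft : L' φ ≤ f * φ s := (div_le_iff₀ hφs).1 (le_csSup hbdd hmem)
  have hf0 : 0 < f := pos_of_mul_pos_left (ht.trans_le hft) zero_le
  set d := δ / φ s with hd
  have hd0 : 0 < d := div_pos hδ hφs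
  have hdφ : d * φ s = δ := div_mul_cancel₀ _ hφs.ne'
  have hnot : f + d ∉ S := fun h => by
    have := le_csSup hbdd h
    rw [← hf] at this
    exact absurd this (not_le.2 (lt_add_of_pos_right f hd0))
  simp only [hS, Set.mem_ofPred_eq, not_forall, not_le] at hnot
  obtain ⟨ψ, hψ⟩ := hnot
  have hcψ : 0 < (f + d) * ψ s := zero_le.trans_lt hψ
  -- Normalized so that `v s = (f + d)⁻¹`; the choice `d = δ / φ s` makes the final error `δ`.
  refine ⟨((f + d) * ψ s)⁻¹ • ψ, ?_, fun w h hw hh => ?_⟩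
  · rw [hL.map_smul, inv_mul_le_iff₀ hcψ, mul_one]
    exact hψ.le
  have hLh := hfS (h * φ)
  rw [ContinuousMap.mul_apply] at hLh
  rcases hh s with h1 | h1
  · rw [h1, one_mul] at hLh
    exact (hft.trans hLh).trans (le_add_of_nonneg_right zero_le)
  · have hψs : ψ s ≠ 0 := fun h => by simp [h] at hcψ
    have hfd : 0 < f + d := add_pos hf0 hd0
    have h2 : 1 ≤ (f + d) * (h s * w s) := by
      rw [← inv_le_iff_one_le_mul₀' hfd]
      refine le_trans (le_of_eq ?_) h1
      simp only [ContinuousMap.smul_apply, smul_eq_mul]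
      field_simp
    have h3 : L' φ * w s ≤ φ s := (hs w).trans (mul_le_of_le_one_left zero_le hw)
    have h4 : L' φ ≤ (f + d) * (h s * φ s) := calc
      L' φ ≤ L' φ * ((f + d) * (h s * w s)) := le_mul_of_one_le_right zero_le h2
      _ = (f + d) * (h s * (L' φ * w s)) := by ring
      _ ≤ _ := by gcongr
    by_cases h5 : h s ≤ 1
    · calc L' φ ≤ (f + d) * (h s * φ s) := h4
        _ = f * (h s * φ s) + h s * (d * φ s) := by ring
        _ ≤ L (h * φ) + 1 * δ := by rw [hdφ]; gcongr
        _ = _ := by rw [one_mul]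
    · refine (hft.trans (le_trans ?_ hLh)).trans (le_add_of_nonneg_right zero_le)
      gcongr
      exact le_mul_of_one_le_left zero_le (le_of_not_ge h5)

/-- If `L = max_j (L' j)`, then each `L' j` is approximated on a finite set of functions by
`φ ↦ L (h j * φ)` for continuous weights with `max_j (h j) = 1`. -/
theorem exists_weights [CompactSpace X] {J : Type*} [Fintype J] [Nonempty J]
    (hL : IsMaxTimes L) {K : J → C(X, ℝ≥0) → ℝ≥0} (hK : ∀ j, IsMaxTimes (K j))
    (hLK : ∀ φ, L φ = Finset.univ.sup fun j => K j φ) (F : Finset C(X, ℝ≥0))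
    {ε : ℝ≥0} (hε : 0 < ε) :
    ∃ h : J → C(X, ℝ≥0), (Finset.univ.sup h = 1) ∧
      ∀ j, ∀ φ ∈ F, L (h j * φ) ≤ K j φ + ε ∧ K j φ ≤ L (h j * φ) + ε := by
  classical
  have hle : ∀ j φ, K j φ ≤ L φ := fun j φ => by
    rw [hLK]
    exact Finset.le_sup (f := fun j => K j φ) (Finset.mem_univ j)
  choose v hv1 hv2 using fun j φ => hL.exists_upper_test (hK j) (hle j) φ hε
  -- `w j` encodes the upper bounds for `K j` on `F`: it is the least function with `φ ≤ (K j φ + ε)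
  -- * w j` for all listed `φ`. Including `1` keeps it nonvanishing, so it can be divided by.
  let w : J → C(X, ℝ≥0) := fun j => (insert 1 F).sup fun φ => (K j φ + ε)⁻¹ • φ
  have hpos : ∀ j φ, 0 < K j φ + ε := fun j φ => add_pos_of_nonneg_of_pos zero_le hε
  have hwφ : ∀ j, ∀ φ ∈ insert 1 F, ∀ x, φ x ≤ (K j φ + ε) * w j x := fun j φ hφ x => by
    rw [← inv_mul_le_iff₀ (hpos j φ)]
    simp only [w, ContinuousMap.finset_sup_apply]
    exact Finset.le_sup (f := fun φ : C(X, ℝ≥0) => ((K j φ + ε)⁻¹ • φ) x) hφ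
  have hw0 : ∀ j x, w j x ≠ 0 := fun j x h0 => by
    have := hwφ j 1 (Finset.mem_insert_self _ _) x
    simp [h0] at this
  have hKw : ∀ j, K j (w j) ≤ 1 := fun j => by
    simp only [w, (hK j).map_finset_sup, (hK j).map_smul]
    refine Finset.sup_le fun φ _ => ?_
    rw [inv_mul_le_iff₀ (hpos j φ), mul_one]
    exact le_add_of_nonneg_right zero_le
  let W : C(X, ℝ≥0) := Finset.univ.inf' Finset.univ_nonempty w
  have hWw : ∀ j x, W x ≤ w j x := fun j x => by
    simp only [W, ContinuousMap.inf'_apply]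
    exact Finset.inf'_le (fun j => w j x) (Finset.mem_univ j)
  let U : C(X, ℝ≥0) := Finset.univ.sup fun j => F.sup fun φ => v j φ
  -- The part `W` forces `max_j (h j) = 1`, the part `U` serves the lower bounds, and `L V ≤ 1`
  -- gives the upper bounds. For `W`, the last uses that `L` is the maximum of the `K j`.
  let V : C(X, ℝ≥0) := W ⊔ U
  have hUV : ∀ j, ∀ φ ∈ F, ∀ x, v j φ x ≤ V x := fun j φ hφ x => by
    refine le_trans ?_ (le_sup_right : U x ≤ W x ⊔ U x)
    simp only [U, ContinuousMap.finset_sup_apply]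
    exact (Finset.le_sup (f := fun φ => v j φ x) hφ).trans
      (Finset.le_sup (f := fun j => F.sup fun φ => v j φ x) (Finset.mem_univ j))
  have hLV : L V ≤ 1 := by
    rw [hL.map_sup]
    refine sup_le ?_ ?_
    · rw [hLK]
      exact Finset.sup_le fun j _ => ((hK j).mono (hWw j)).trans (hKw j)
    · simp only [U, hL.map_finset_sup]
      exact Finset.sup_le fun j _ => Finset.sup_le fun φ _ => hv1 j φ
  let h : J → C(X, ℝ≥0) := fun j =>
    ⟨fun x => min 1 (V x / w j x),
      continuous_const.min (V.continuous.div₀ (w j).continuous (hw0 j))⟩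
  have hh : ∀ j x, h j x = min 1 (V x / w j x) := fun _ _ => rfl
  refine ⟨h, ?_, fun j φ hφ => ⟨?_, ?_⟩⟩
  · ext1 x
    rw [ContinuousMap.finset_sup_apply, ContinuousMap.one_apply]
    refine le_antisymm (Finset.sup_le fun j _ => min_le_left _ _) ?_
    -- At an index where `w j x` is minimal, `V x ≥ W x = w j x`, so the weight equals `1`.
    obtain ⟨j, _, hj⟩ := Finset.exists_mem_eq_inf' Finset.univ_nonempty fun j => w j x
    refine le_trans ?_ (Finset.le_sup (f := fun j => h j x) (Finset.mem_univ j))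
    rw [hh]
    refine le_min le_rfl ?_
    rw [one_le_div (pos_iff_ne_zero.2 (hw0 j x)), ← hj, ← ContinuousMap.inf'_apply]
    exact (le_sup_left : W x ≤ W x ⊔ U x)
  · refine le_trans (hL.map_le_mul (ψ := V) (c := K j φ + ε) fun x => ?_)
      (mul_le_of_le_one_right zero_le hLV)
    calc h j x * φ x ≤ (V x / w j x) * ((K j φ + ε) * w j x) :=
          mul_le_mul' (min_le_right _ _) (hwφ j φ (Finset.mem_insert_of_mem hφ) x)
      _ = (K j φ + ε) * V x := by
          have := hw0 j x
          field_simp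
  · refine hv2 j φ (w j) (h j) (hKw j) fun s => ?_
    rcases le_total 1 (V s / w j s) with h1 | h1
    · exact Or.inl (by rw [hh, min_eq_left h1])
    · refine Or.inr ?_
      rw [hh, min_eq_right h1, div_mul_cancel₀ _ (hw0 j s)]
      exact hUV j φ hφ s

end IsMaxTimes

theorem unitInterval.coe_sup (a b : I) : ((a ⊔ b : I) : ℝ) = max (a : ℝ) b := by
  rcases le_total a b with h | h
  · rw [sup_eq_right.2 h, max_eq_right (Subtype.coe_le_coe.2 h)]
  · rw [sup_eq_left.2 h, max_eq_left (Subtype.coe_le_coe.2 h)]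

/-! ### Passing between `[0,1]`-valued and nonnegative functions. -/

section Truncation

variable {X : Type*} [TopologicalSpace X]

/-- Inclusion of `C(X, [0,1])` into the nonnegative functions. -/
def toNNRealMap (φ : C(X, I)) : C(X, ℝ≥0) :=
  ⟨fun x => unitInterval.toNNReal (φ x), unitInterval.toNNReal_continuous.comp φ.continuous⟩

/-- Truncation of a nonnegative function at height `1`. -/
def truncMap (φ : C(X, ℝ≥0)) : C(X, I) :=
  ⟨fun x => ⟨min (φ x) 1, le_min (φ x).2 zero_le_one, min_le_right _ _⟩, by fun_prop⟩

theorem coe_truncMap (φ : C(X, ℝ≥0)) (x : X) : (truncMap φ x : ℝ) = min (φ x : ℝ) 1 := rfl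

theorem coe_toNNRealMap (φ : C(X, I)) (x : X) : ((toNNRealMap φ x : ℝ≥0) : ℝ) = φ x := rfl

theorem toNNRealMap_le_one (φ : C(X, I)) (x : X) : toNNRealMap φ x ≤ 1 := (φ x).2.2

theorem truncMap_toNNRealMap (φ : C(X, I)) : truncMap (toNNRealMap φ) = φ := by
  ext x
  rw [coe_truncMap, coe_toNNRealMap, min_eq_left (φ x).2.2]

theorem toNNRealMap_truncMap {φ : C(X, ℝ≥0)} (h : ∀ x, φ x ≤ 1) :
    toNNRealMap (truncMap φ) = φ := by
  ext x
  rw [coe_toNNRealMap, coe_truncMap, min_eq_left (by exact_mod_cast h x)]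

theorem truncMap_sup (φ ψ : C(X, ℝ≥0)) : truncMap (φ ⊔ ψ) = truncMap φ ⊔ truncMap ψ := by
  ext x
  have h : ((truncMap φ ⊔ truncMap ψ) x : ℝ) = max (truncMap φ x : ℝ) (truncMap ψ x) :=
    unitInterval.coe_sup _ _
  rw [h]
  simp only [coe_truncMap, ContinuousMap.sup_apply, NNReal.coe_max]
  exact min_max_distrib_right _ _ _

theorem toNNRealMap_sup (φ ψ : C(X, I)) :
    toNNRealMap (φ ⊔ ψ) = toNNRealMap φ ⊔ toNNRealMap ψ := by
  ext x
  exact unitInterval.coe_sup _ _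

theorem ContinuousMap.exists_ne_zero_forall_le [CompactSpace X] (φ : C(X, ℝ≥0)) :
    ∃ c : ℝ≥0, c ≠ 0 ∧ ∀ x, φ x ≤ c := by
  obtain ⟨c, hc⟩ := (isCompact_range φ.continuous).bddAbove
  exact ⟨c + 1, (add_pos_of_nonneg_of_pos zero_le one_pos).ne',
    fun x => (hc ⟨x, rfl⟩).trans (le_add_of_nonneg_right zero_le)⟩

/-- A constant bounding a nonnegative continuous function on a compact space. -/
noncomputable def boundOf [CompactSpace X] (φ : C(X, ℝ≥0)) : ℝ≥0 := φ.exists_ne_zero_forall_le.choose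

theorem boundOf_ne_zero [CompactSpace X] (φ : C(X, ℝ≥0)) : boundOf φ ≠ 0 :=
  φ.exists_ne_zero_forall_le.choose_spec.1

theorem le_boundOf [CompactSpace X] (φ : C(X, ℝ≥0)) (x : X) : φ x ≤ boundOf φ :=
  φ.exists_ne_zero_forall_le.choose_spec.2 x

end Truncation

/-! ### Homogeneous extension of measures, and compactness of the space of measures. -/

section Extension

variable {X : Type*} [TopologicalSpace X]

theorem toNNReal_apply_const_mul (μ : dotMeasures X) (c : I) (φ : C(X, I)) :
    unitInterval.toNNReal ((μ : C(X, I) → I) (ContinuousMap.const X c * φ)) =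
      unitInterval.toNNReal c * unitInterval.toNNReal ((μ : C(X, I) → I) φ) := by
  rw [μ.2.2.1]
  ext
  simp

/-- The restriction of a normed homogeneous sup-preserving functional to `C(X, [0,1])`. -/
def restrict {L : C(X, ℝ≥0) → ℝ≥0} (hL : IsMaxTimes L) (h1 : L 1 = 1) : dotMeasures X :=
  ⟨fun φ => ⟨L (toNNRealMap φ), (L _).2, by
      rw [← NNReal.coe_one, ← h1]
      exact_mod_cast hL.mono (toNNRealMap_le_one φ)⟩, by
    refine ⟨Subtype.ext ?_, fun c φ => Subtype.ext ?_, fun φ ψ => Subtype.ext ?_⟩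
    · have h : toNNRealMap (ContinuousMap.const X (1 : I)) = 1 := by
        ext x
        simp [coe_toNNRealMap]
      exact congrArg NNReal.toReal ((congrArg L h).trans h1)
    · have h : toNNRealMap (ContinuousMap.const X c * φ) =
          unitInterval.toNNReal c • toNNRealMap φ := by
        ext x
        simp [coe_toNNRealMap]
      exact congrArg NNReal.toReal ((congrArg L h).trans (hL.map_smul _ _))
    · refine Eq.trans ?_ (unitInterval.coe_sup _ _).symm
      simp [toNNRealMap_sup, hL.map_sup]⟩

theorem toNNReal_restrict {L : C(X, ℝ≥0) → ℝ≥0} (hL : IsMaxTimes L) (h1 : L 1 = 1)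
    (φ : C(X, I)) :
    unitInterval.toNNReal ((restrict hL h1 : C(X, I) → I) φ) = L (toNNRealMap φ) := rfl

/-- Homogeneity for the factor `c / d ≤ 1` makes the extension independent of the bound used for
rescaling. -/
theorem mul_apply_truncMap_of_le (μ : dotMeasures X) {φ : C(X, ℝ≥0)} {c d : ℝ≥0} (hc : c ≠ 0)
    (hcd : c ≤ d) (hφ : ∀ x, φ x ≤ c) :
    d * unitInterval.toNNReal ((μ : C(X, I) → I) (truncMap (d⁻¹ • φ))) =
      c * unitInterval.toNNReal ((μ : C(X, I) → I) (truncMap (c⁻¹ • φ))) := by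
  have hc' := pos_iff_ne_zero.2 hc
  have hd : 0 < d := hc'.trans_le hcd
  let r : I := ⟨(c / d : ℝ≥0), (c / d).2, by exact_mod_cast div_le_one_of_le₀ hcd zero_le⟩
  have key : truncMap (d⁻¹ • φ) = ContinuousMap.const X r * truncMap (c⁻¹ • φ) := by
    ext x
    have h1 : d⁻¹ * φ x ≤ 1 := by
      rw [inv_mul_le_iff₀ hd, mul_one]
      exact (hφ x).trans hcd
    have h2 : c⁻¹ * φ x ≤ 1 := by
      rw [inv_mul_le_iff₀ hc', mul_one]
      exact hφ x
    have h3 : (truncMap (d⁻¹ • φ) x : ℝ) = (d⁻¹ * φ x : ℝ≥0) :=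
      min_eq_left (by exact_mod_cast h1)
    have h4 : (truncMap (c⁻¹ • φ) x : ℝ) = (c⁻¹ * φ x : ℝ≥0) :=
      min_eq_left (by exact_mod_cast h2)
    have h5 : (((ContinuousMap.const X r * truncMap (c⁻¹ • φ)) x : I) : ℝ) =
      (c / d : ℝ≥0) * (truncMap (c⁻¹ • φ) x : ℝ) := rfl
    rw [h5, h3, h4, ← NNReal.coe_mul]
    congr 1
    field_simp
  rw [key, toNNReal_apply_const_mul]
  have : unitInterval.toNNReal r = c / d := rfl
  rw [this]
  field_simp

variable [CompactSpace X]

/-- The homogeneous extension of a `·`-measure to all nonnegative continuous functions. -/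
noncomputable def extend (μ : dotMeasures X) (φ : C(X, ℝ≥0)) : ℝ≥0 :=
  boundOf φ * unitInterval.toNNReal ((μ : C(X, I) → I) (truncMap ((boundOf φ)⁻¹ • φ)))

theorem extend_eq (μ : dotMeasures X) {φ : C(X, ℝ≥0)} {c : ℝ≥0} (hc : c ≠ 0)
    (hφ : ∀ x, φ x ≤ c) : extend μ φ =
      c * unitInterval.toNNReal ((μ : C(X, I) → I) (truncMap (c⁻¹ • φ))) := by
  rcases le_total c (boundOf φ) with h | h
  · exact mul_apply_truncMap_of_le μ hc h hφ
  · exact (mul_apply_truncMap_of_le μ (boundOf_ne_zero φ) h (le_boundOf φ)).symm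

theorem extend_of_le_one (μ : dotMeasures X) {φ : C(X, ℝ≥0)} (hφ : ∀ x, φ x ≤ 1) :
    extend μ φ = unitInterval.toNNReal ((μ : C(X, I) → I) (truncMap φ)) := by
  rw [extend_eq μ one_ne_zero hφ, inv_one, one_smul, one_mul]

theorem extend_toNNRealMap (μ : dotMeasures X) (φ : C(X, I)) :
    extend μ (toNNRealMap φ) = unitInterval.toNNReal ((μ : C(X, I) → I) φ) := by
  rw [extend_of_le_one μ (toNNRealMap_le_one φ), truncMap_toNNRealMap]

theorem extend_one (μ : dotMeasures X) : extend μ 1 = 1 := by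
  have h : toNNRealMap (ContinuousMap.const X (1 : I)) = 1 := by
    ext x
    simp [coe_toNNRealMap]
  rw [← h, extend_toNNRealMap, μ.2.1]
  ext
  simp

theorem toNNReal_sup (a b : I) : unitInterval.toNNReal (a ⊔ b) =
    unitInterval.toNNReal a ⊔ unitInterval.toNNReal b := by
  ext
  exact unitInterval.coe_sup _ _

theorem isMaxTimes_extend (μ : dotMeasures X) : IsMaxTimes (extend μ) where
  map_smul c φ := by
    rcases eq_or_ne c 0 with rfl | hc
    · rw [zero_smul, zero_mul, extend_of_le_one μ fun x => zero_le_one]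
      have h : truncMap (0 : C(X, ℝ≥0)) = ContinuousMap.const X 0 * 1 := by
        ext x
        simp [coe_truncMap]
      rw [h, toNNReal_apply_const_mul]
      ext
      simp
    · rw [extend_eq μ (mul_ne_zero hc (boundOf_ne_zero φ)) fun x => by
        simp only [ContinuousMap.smul_apply, smul_eq_mul]
        gcongr
        exact le_boundOf φ x]
      rw [extend, smul_smul, mul_assoc, mul_inv, mul_right_comm, inv_mul_cancel₀ hc, one_mul]
  map_sup φ ψ := by
    set c := boundOf φ ⊔ boundOf ψ with hc
    have hc0 : c ≠ 0 :=
      (lt_of_lt_of_le (pos_iff_ne_zero.2 (boundOf_ne_zero φ)) le_sup_left).ne'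
    have h1 : ∀ x, φ x ≤ c := fun x => (le_boundOf φ x).trans le_sup_left
    have h2 : ∀ x, ψ x ≤ c := fun x => (le_boundOf ψ x).trans le_sup_right
    have h3 : c⁻¹ • (φ ⊔ ψ) = c⁻¹ • φ ⊔ c⁻¹ • ψ := by
      ext x
      simp [mul_max_of_nonneg]
    rw [extend_eq μ hc0 h1, extend_eq μ hc0 h2, extend_eq μ hc0 fun x => sup_le (h1 x) (h2 x),
      h3, truncMap_sup, μ.2.2.2, toNNReal_sup, mul_max_of_nonneg _ _ zero_le]

theorem continuous_extend (φ : C(X, ℝ≥0)) : Continuous fun μ : dotMeasures X => extend μ φ :=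
  continuous_const.mul (unitInterval.toNNReal_continuous.comp
    ((continuous_apply _).comp continuous_subtype_val))

theorem extend_restrict {L : C(X, ℝ≥0) → ℝ≥0} (hL : IsMaxTimes L) (h1 : L 1 = 1) :
    extend (restrict hL h1) = L := by
  funext φ
  have hb := boundOf_ne_zero φ
  rw [extend, toNNReal_restrict, toNNRealMap_truncMap, hL.map_smul, mul_inv_cancel_left₀ hb]
  intro x
  simp only [ContinuousMap.smul_apply, smul_eq_mul]
  rw [inv_mul_le_iff₀ (pos_iff_ne_zero.2 hb), mul_one]
  exact le_boundOf φ x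

theorem extend_injective : Function.Injective (extend (X := X)) := fun μ ν h => by
  refine Subtype.ext (funext fun φ => Subtype.ext ?_)
  have := congrFun h (toNNRealMap φ)
  rw [extend_toNNRealMap, extend_toNNRealMap] at this
  exact congrArg NNReal.toReal this

theorem isInducing_extend : IsInducing (extend (X := X)) := by
  have h1 : IsInducing unitInterval.toNNReal :=
    .of_comp unitInterval.toNNReal_continuous NNReal.continuous_coe IsInducing.subtypeVal
  have h2 : IsInducing fun (μ : dotMeasures X) (φ : C(X, I)) =>
      unitInterval.toNNReal ((μ : C(X, I) → I) φ) :=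
    (IsInducing.piMap fun _ : C(X, I) => h1).comp IsInducing.subtypeVal
  refine .of_comp (g := fun L φ => L (toNNRealMap φ)) (continuous_pi continuous_extend)
    (by fun_prop) ?_
  convert h2 using 1
  funext μ φ
  exact extend_toNNRealMap μ φ

theorem isClosed_dotMeasures (X : Type*) [TopologicalSpace X] : IsClosed (dotMeasures X) := by
  have h1 : IsClosed {μ : C(X, I) → I | μ (ContinuousMap.const X 1) = 1} :=
    isClosed_eq (continuous_apply _) continuous_const
  have h2 : IsClosed (⋂ (c : I) (φ : C(X, I)),
      {μ : C(X, I) → I | μ (ContinuousMap.const X c * φ) = c * μ φ}) :=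
    isClosed_iInter fun c => isClosed_iInter fun φ => isClosed_eq (by fun_prop) (by fun_prop)
  have h3 : IsClosed (⋂ (φ : C(X, I)) (ψ : C(X, I)),
      {μ : C(X, I) → I | μ (φ ⊔ ψ) = μ φ ⊔ μ ψ}) :=
    isClosed_iInter fun c => isClosed_iInter fun φ => isClosed_eq (by fun_prop)
      ((continuous_apply c).max (continuous_apply φ))
  convert h1.inter (h2.inter h3) using 1
  ext μ
  simp [dotMeasures]

instance compactSpace_dotMeasures (X : Type*) [TopologicalSpace X] : CompactSpace (dotMeasures X) :=
  isCompact_iff_compactSpace.1 (isClosed_dotMeasures X).isCompact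

end Extension

/-- Neighborhoods in a space whose topology is induced from a power of `ℝ≥0`. -/
theorem Topology.IsInducing.exists_finset_forall_le {Z T : Type*} [TopologicalSpace Z]
    {e : Z → T → ℝ≥0} (he : IsInducing e) {z : Z} {U : Set Z} (hU : U ∈ 𝓝 z) :
    ∃ F : Finset T, ∃ ε : ℝ≥0, 0 < ε ∧
      ∀ z', (∀ t ∈ F, e z' t ≤ e z t + ε ∧ e z t ≤ e z' t + ε) → z' ∈ U := by
  classical
  rw [he.nhds_eq_comap, Filter.mem_comap] at hU
  obtain ⟨V, hV, hVU⟩ := hU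
  rw [nhds_pi, Filter.mem_pi'] at hV
  obtain ⟨F, t, ht, hFV⟩ := hV
  choose r hr hrt using fun i => Metric.nhds_basis_closedBall.mem_iff.1 (ht i)
  have hδ : ∃ ε : ℝ≥0, 0 < ε ∧ ∀ i ∈ F, (ε : ℝ) ≤ r i := by
    rcases F.eq_empty_or_nonempty with rfl | hF
    · exact ⟨1, one_pos, by simp⟩
    · obtain ⟨j, _, hj⟩ := F.exists_min_image r hF
      exact ⟨⟨r j, (hr j).le⟩, hr j, hj⟩
  obtain ⟨ε, hε, hεr⟩ := hδ
  refine ⟨F, ε, hε, fun z' hz' => hVU (hFV fun i hi => hrt i ?_)⟩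
  refine Metric.mem_closedBall.2 (le_trans ?_ (hεr i hi))
  obtain ⟨h1, h2⟩ := hz' i hi
  rw [NNReal.dist_eq, abs_sub_le_iff]
  have h1' : (e z' i : ℝ) ≤ e z i + ε := by exact_mod_cast h1
  have h2' : (e z i : ℝ) ≤ e z' i + ε := by exact_mod_cast h2
  constructor <;> linarith

theorem IsMaxTimes.eq_zero_of_map_one {X : Type*} [TopologicalSpace X] [CompactSpace X]
    {L : C(X, ℝ≥0) → ℝ≥0} (hL : IsMaxTimes L) (h : L 1 = 0) (φ : C(X, ℝ≥0)) : L φ = 0 := by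
  have h1 : L φ ≤ boundOf φ * L 1 := hL.map_le_mul fun x => by simpa using le_boundOf φ x
  rwa [h, mul_zero, nonpos_iff_eq_zero] at h1

theorem IsMaxTimes.const_mul {X : Type*} [TopologicalSpace X] {L : C(X, ℝ≥0) → ℝ≥0}
    (hL : IsMaxTimes L) (a : ℝ≥0) : IsMaxTimes fun φ => a * L φ where
  map_smul c φ := by rw [hL.map_smul, mul_left_comm]
  map_sup φ ψ := by rw [hL.map_sup, mul_max_of_nonneg _ _ zero_le]

/-- The space of homogeneous sup-preserving functionals, with the topology of pointwise
convergence. -/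
abbrev MaxTimes (X : Type*) [TopologicalSpace X] := {L : C(X, ℝ≥0) → ℝ≥0 // IsMaxTimes L}

theorem MaxTimes.continuous_apply {X : Type*} [TopologicalSpace X] (φ : C(X, ℝ≥0)) :
    Continuous fun L : MaxTimes X => L.1 φ :=
  (_root_.continuous_apply φ).comp continuous_subtype_val

/-! ### Finite maxima of scaled Dirac measures and continuous sections. -/

section Combine

variable {X : Type*} [TopologicalSpace X] [CompactSpace X]

open Classical in
/-- The `·`-measure proportional to a nonzero functional (and `d` for the zero functional). -/
noncomputable def toDotMeasure (d : dotMeasures X) (L : MaxTimes X) : dotMeasures X :=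
  if h : L.1 1 = 0 then d
  else restrict (L.2.const_mul (L.1 1)⁻¹) (inv_mul_cancel₀ h)

theorem extend_toDotMeasure (d : dotMeasures X) {L : MaxTimes X} (h : L.1 1 ≠ 0)
    (φ : C(X, ℝ≥0)) : extend (toDotMeasure d L) φ = (L.1 1)⁻¹ * L.1 φ := by
  rw [toDotMeasure, dif_neg h, extend_restrict]

theorem map_one_mul_extend_toDotMeasure (d : dotMeasures X) (L : MaxTimes X) (φ : C(X, ℝ≥0)) :
    L.1 1 * extend (toDotMeasure d L) φ = L.1 φ := by
  rcases eq_or_ne (L.1 1) 0 with h | h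
  · rw [h, zero_mul, L.2.eq_zero_of_map_one h]
  · rw [extend_toDotMeasure d h, mul_inv_cancel_left₀ h]

theorem continuousAt_toDotMeasure (d : dotMeasures X) {L : MaxTimes X} (h : L.1 1 ≠ 0) :
    ContinuousAt (toDotMeasure d) L := by
  rw [isInducing_extend.continuousAt_iff, continuousAt_pi]
  intro φ
  have h1 : ContinuousAt (fun L : MaxTimes X => (L.1 1)⁻¹ * L.1 φ) L :=
    ((MaxTimes.continuous_apply 1).continuousAt.inv₀ h).mul
      (MaxTimes.continuous_apply φ).continuousAt
  refine h1.congr ?_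
  filter_upwards [(MaxTimes.continuous_apply 1).continuousAt.eventually_ne h] with L' hL'
  exact (extend_toDotMeasure d hL' φ).symm

/-- Normalization may be discontinuous where `L 1 = 0`, but there the factor `L 1` tends to `0`
while `Φ` stays bounded. Hence the default `d` is harmless. -/
theorem continuous_map_one_mul_toDotMeasure (d : dotMeasures X) (Φ : C(dotMeasures X, ℝ≥0)) :
    Continuous fun L : MaxTimes X => L.1 1 * Φ (toDotMeasure d L) := by
  rw [continuous_iff_continuousAt]
  intro L
  have h1 := (MaxTimes.continuous_apply (X := X) 1).continuousAt (x := L)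
  rcases eq_or_ne (L.1 1) 0 with h | h
  · have h2 : Filter.Tendsto (fun L : MaxTimes X => L.1 1 * boundOf Φ) (𝓝 L) (𝓝 0) := by
      simpa [ContinuousAt, h] using h1.mul_const (boundOf Φ)
    rw [ContinuousAt, h, zero_mul]
    exact tendsto_of_tendsto_of_tendsto_of_le_of_le tendsto_const_nhds h2 (fun _ => zero_le)
      fun L' => mul_le_mul_right (le_boundOf Φ _) _
  · exact h1.mul (Φ.continuous.continuousAt.comp (continuousAt_toDotMeasure d h))

/-- The functional `max_j (ρ j 1) • δ_{ρ j / ρ j 1}` on functions on the space of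
`·`-measures. -/
noncomputable def combine {J : Type*} [Fintype J] (d : dotMeasures X) (ρ : J → MaxTimes X)
    (Φ : C(dotMeasures X, ℝ≥0)) : ℝ≥0 :=
  Finset.univ.sup fun j => (ρ j).1 1 * Φ (toDotMeasure d (ρ j))

variable {J : Type*} [Fintype J]

theorem isMaxTimes_combine (d : dotMeasures X) (ρ : J → MaxTimes X) :
    IsMaxTimes (combine d ρ) where
  map_smul c Φ := by
    simp only [combine, NNReal.mul_finset_sup, ContinuousMap.smul_apply, smul_eq_mul]
    simp only [mul_left_comm]
  map_sup Φ Ψ := by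
    simp only [combine, ContinuousMap.sup_apply, ← Finset.sup_sup, Pi.sup_def,
      mul_max_of_nonneg _ _ zero_le]

theorem combine_one (d : dotMeasures X) (ρ : J → MaxTimes X) :
    combine d ρ 1 = Finset.univ.sup fun j => (ρ j).1 1 := by
  simp [combine]

theorem continuous_combine (d : dotMeasures X) (Φ : C(dotMeasures X, ℝ≥0)) :
    Continuous fun ρ : J → MaxTimes X => combine d ρ Φ :=
  Continuous.finset_sup_apply fun j _ =>
    (continuous_map_one_mul_toDotMeasure d Φ).comp (_root_.continuous_apply j)

/-- Evaluation at `φ`, as a function on the space of `·`-measures. -/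
noncomputable def evalMap (φ : C(X, ℝ≥0)) : C(dotMeasures X, ℝ≥0) :=
  ⟨fun μ => extend μ φ, continuous_extend φ⟩

theorem evalMap_apply (φ : C(X, ℝ≥0)) (μ : dotMeasures X) : evalMap φ μ = extend μ φ := rfl

theorem evalMap_one : evalMap (1 : C(X, ℝ≥0)) = 1 := by
  ext μ
  rw [evalMap_apply, extend_one, ContinuousMap.one_apply]

theorem combine_evalMap (d : dotMeasures X) (ρ : J → MaxTimes X) (φ : C(X, ℝ≥0)) :
    combine d ρ (evalMap φ) = Finset.univ.sup fun j => (ρ j).1 φ := by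
  simp only [combine, evalMap_apply, map_one_mul_extend_toDotMeasure]

theorem isMaxTimes_comp_evalMap {L : C(dotMeasures X, ℝ≥0) → ℝ≥0} (hL : IsMaxTimes L) :
    IsMaxTimes fun φ : C(X, ℝ≥0) => L (evalMap φ) where
  map_smul c φ := by
    rw [← hL.map_smul]
    congr 1
    ext μ
    exact congrArg NNReal.toReal ((isMaxTimes_extend μ).map_smul c φ)
  map_sup φ ψ := by
    rw [← hL.map_sup]
    congr 1
    ext μ
    exact congrArg NNReal.toReal ((isMaxTimes_extend μ).map_sup φ ψ)

theorem extend_dotBarycenterMap (M : dotMeasures (dotMeasures X)) (φ : C(X, ℝ≥0)) :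
    extend (dotBarycenterMap X M) φ = extend M (evalMap φ) := by
  have hL := isMaxTimes_comp_evalMap (isMaxTimes_extend M)
  have h1 : extend M (evalMap (1 : C(X, ℝ≥0))) = 1 := by rw [evalMap_one, extend_one]
  have key : dotBarycenterMap X M = restrict hL h1 := by
    refine Subtype.ext (funext fun ψ => Subtype.ext ?_)
    have h2 : evalMap (toNNRealMap ψ) = toNNRealMap (coordOn (dotMeasures X) ψ) := by
      ext μ
      rw [evalMap_apply, extend_toNNRealMap]
      rfl
    have h3 : extend M (evalMap (toNNRealMap ψ)) =
        unitInterval.toNNReal ((M : C(dotMeasures X, I) → I) (coordOn (dotMeasures X) ψ)) := by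
      rw [h2, extend_toNNRealMap]
    exact (congrArg NNReal.toReal h3).symm
  rw [key, extend_restrict]

theorem finset_sup_mul_right {ι : Type*} (s : Finset ι) {Y : Type*} [TopologicalSpace Y]
    (h : ι → C(Y, ℝ≥0)) (φ : C(Y, ℝ≥0)) : (s.sup fun j => h j * φ) = s.sup h * φ := by
  ext1 x
  simp only [ContinuousMap.finset_sup_apply, ContinuousMap.mul_apply, NNReal.finset_sup_mul]

theorem IsMaxTimes.sup_map_mul {Y : Type*} [TopologicalSpace Y] {L : C(Y, ℝ≥0) → ℝ≥0}
    (hL : IsMaxTimes L) {h : J → C(Y, ℝ≥0)} (hh : Finset.univ.sup h = 1) (φ : C(Y, ℝ≥0)) :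
    (Finset.univ.sup fun j => L (h j * φ)) = L φ := by
  rw [← hL.map_finset_sup, finset_sup_mul_right, hh, one_mul]

/-- The functionals `φ ↦ ν (h j * φ)`. -/
noncomputable def weighted (h : J → C(X, ℝ≥0)) (ν : dotMeasures X) (j : J) : MaxTimes X :=
  ⟨fun φ => extend ν (h j * φ), (isMaxTimes_extend ν).comp_mul (h j)⟩

theorem continuous_weighted {ι : Type*} (h : ι → C(X, ℝ≥0)) : Continuous (weighted h) :=
  continuous_pi fun j => Continuous.subtype_mk
    (continuous_pi fun φ => continuous_extend (h j * φ)) _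

theorem combine_weighted_one {h : J → C(X, ℝ≥0)} (hh : Finset.univ.sup h = 1)
    (d ν : dotMeasures X) : combine d (weighted h ν) 1 = 1 := by
  rw [combine_one]
  exact ((isMaxTimes_extend ν).sup_map_mul hh 1).trans (extend_one ν)

/-- A continuous section of the barycenter map determined by weights with maximum `1`. -/
noncomputable def barycenterSection {h : J → C(X, ℝ≥0)} (hh : Finset.univ.sup h = 1)
    (d ν : dotMeasures X) : dotMeasures (dotMeasures X) :=
  restrict (isMaxTimes_combine d (weighted h ν)) (combine_weighted_one hh d ν)

theorem extend_barycenterSection {h : J → C(X, ℝ≥0)} (hh : Finset.univ.sup h = 1)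
    (d ν : dotMeasures X) :
    extend (barycenterSection hh d ν) = combine d (weighted h ν) :=
  extend_restrict _ _

theorem dotBarycenterMap_barycenterSection {h : J → C(X, ℝ≥0)}
    (hh : Finset.univ.sup h = 1) (d ν : dotMeasures X) :
    dotBarycenterMap X (barycenterSection hh d ν) = ν := by
  refine extend_injective (funext fun φ => ?_)
  rw [extend_dotBarycenterMap, extend_barycenterSection, combine_evalMap]
  exact (isMaxTimes_extend ν).sup_map_mul hh φ

theorem continuous_barycenterSection {h : J → C(X, ℝ≥0)} (hh : Finset.univ.sup h = 1)
    (d : dotMeasures X) : Continuous (barycenterSection hh d) := by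
  rw [isInducing_extend.continuous_iff, continuous_pi_iff]
  intro Φ
  simp only [Function.comp_apply, extend_barycenterSection]
  exact (continuous_combine d Φ).comp (continuous_weighted h)

end Combine

/-! ### Approximation by finitely supported measures with the same barycenter. -/

section Localize

theorem IsMaxTimes.map_mul_le_of_le {Y : Type*} [TopologicalSpace Y] {L : C(Y, ℝ≥0) → ℝ≥0}
    (hL : IsMaxTimes L) {P Φ : C(Y, ℝ≥0)} {a : ℝ≥0} (h : ∀ y, P y ≠ 0 → Φ y ≤ a) :
    L (P * Φ) ≤ a * L P := by
  refine hL.map_le_mul fun y => ?_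
  rcases eq_or_ne (P y) 0 with h0 | h0
  · simp [h0]
  · rw [ContinuousMap.mul_apply, mul_comm]
    gcongr
    exact h y h0

theorem IsMaxTimes.mul_le_map_mul_add {Y : Type*} [TopologicalSpace Y]
    {L : C(Y, ℝ≥0) → ℝ≥0} (hL : IsMaxTimes L) {P Φ : C(Y, ℝ≥0)} {a δ : ℝ≥0}
    (h : ∀ y, P y ≠ 0 → a ≤ Φ y + δ) : a * L P ≤ L (P * Φ) + δ * L P := by
  rw [← tsub_le_iff_right, ← tsub_mul]
  refine hL.mul_le_map fun y => ?_
  rcases eq_or_ne (P y) 0 with h0 | h0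
  · simp [h0]
  · rw [ContinuousMap.mul_apply, mul_comm]
    gcongr
    exact tsub_le_iff_right.2 (h y h0)

theorem exists_bump {Y : Type*} [TopologicalSpace Y] [CompletelyRegularSpace Y] {y : Y}
    {C : Set Y} (hC : C ∈ 𝓝 y) : ∃ B : C(Y, ℝ≥0), B y ≠ 0 ∧ ∀ z, B z ≠ 0 → z ∈ C := by
  obtain ⟨f, hf, hy, h1⟩ := CompletelyRegularSpace.completely_regular y (interior C)ᶜ
    isOpen_interior.isClosed_compl (by simpa using mem_interior_iff_mem_nhds.2 hC)
  refine ⟨⟨fun z => unitInterval.toNNReal (unitInterval.symm (f z)),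
    unitInterval.toNNReal_continuous.comp (unitInterval.continuous_symm.comp hf)⟩, ?_,
    fun z hz => ?_⟩
  · intro h
    have := congrArg NNReal.toReal h
    simp [hy] at this
  · by_contra hzC
    refine hz ?_
    have h2 : f z = 1 := h1 fun h => hzC (interior_subset h)
    ext
    simp [h2]

/-- A finite partition of unity for the maximum, subordinate to given neighborhoods. -/
theorem exists_max_partition {Y : Type*} [TopologicalSpace Y] [CompactSpace Y]
    [CompletelyRegularSpace Y] (C : Y → Set Y) (hC : ∀ y, C y ∈ 𝓝 y) :
    ∃ (t : Finset Y) (P : t → C(Y, ℝ≥0)), Finset.univ.sup P = 1 ∧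
      ∀ j z, P j z ≠ 0 → z ∈ C j := by
  choose B hB1 hB2 using fun y => exists_bump (hC y)
  obtain ⟨t, ht⟩ := CompactSpace.elim_nhds_subcover (fun y => {z | B y z ≠ 0})
    fun y => (isOpen_ne_fun (B y).continuous continuous_const).mem_nhds (hB1 y)
  let S : C(Y, ℝ≥0) := Finset.univ.sup fun j : t => B j
  have hS : ∀ z, S z ≠ 0 := fun z => by
    have hz : z ∈ ⋃ y ∈ t, {z | B y z ≠ 0} := ht ▸ Set.mem_univ z
    simp only [Set.mem_iUnion] at hz
    obtain ⟨y, hy, hz⟩ := hz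
    have hle : B y z ≤ S z := by
      simp only [S, ContinuousMap.finset_sup_apply]
      exact Finset.le_sup (f := fun j : t => B j z) (Finset.mem_univ ⟨y, hy⟩)
    exact ((pos_iff_ne_zero.2 hz).trans_le hle).ne'
  let R : C(Y, ℝ≥0) := ⟨fun z => (S z)⁻¹, S.continuous.inv₀ hS⟩
  refine ⟨t, fun j => B j * R, ?_, fun j z hz => hB2 j z (left_ne_zero_of_mul hz)⟩
  rw [finset_sup_mul_right]
  ext1 z
  exact mul_inv_cancel₀ (hS z)

variable {X : Type*} [TopologicalSpace X] [CompactSpace X]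

/-- A `·`-measure on the space of `·`-measures is approximated by finitely supported ones with the
same barycenter. -/
theorem exists_combine_approx (M : dotMeasures (dotMeasures X)) (d : dotMeasures X)
    (G : Finset C(dotMeasures X, ℝ≥0)) {ε : ℝ≥0} (hε : 0 < ε) :
    ∃ (t : Finset (dotMeasures X)) (ρ : t → MaxTimes X),
      (∀ φ, extend (dotBarycenterMap X M) φ = Finset.univ.sup fun j => (ρ j).1 φ) ∧
      ∀ Φ ∈ G, combine d ρ Φ ≤ extend M Φ + ε ∧ extend M Φ ≤ combine d ρ Φ + ε := by
  have hU : ∀ μ : dotMeasures X, {κ : dotMeasures X | ∀ Φ ∈ G, Φ κ < Φ μ + ε / 2 ∧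
      Φ μ < Φ κ + ε / 2} ∈ 𝓝 μ := fun μ => by
    have h2 : 0 < ε / 2 := half_pos hε
    refine (Filter.eventually_all_finset G).2 fun Φ _ => ?_
    have hΦ := Φ.continuous.continuousAt (x := μ)
    exact (hΦ.eventually_lt continuousAt_const (lt_add_of_pos_right _ h2)).and
      (continuousAt_const.eventually_lt (hΦ.add continuousAt_const) (lt_add_of_pos_right _ h2))
  -- The neighborhoods are shrunk to boxes given by bounds on finitely many evaluations. Such bounds
  -- pass to barycenters, so a piece of `M` living in a box has its normalized barycenter in the
  -- closed box.
  choose F δ hδ hF using fun μ => isInducing_extend.exists_finset_forall_le (hU μ)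
  obtain ⟨t, P, hP1, hP2⟩ := exists_max_partition
    (fun μ => {κ | ∀ φ ∈ F μ, extend κ φ < extend μ φ + δ μ ∧ extend μ φ < extend κ φ + δ μ})
    fun μ => (Filter.eventually_all_finset (F μ)).2 fun φ _ =>
      have hφ := (continuous_extend φ).continuousAt (x := μ)
      (hφ.eventually_lt continuousAt_const (lt_add_of_pos_right _ (hδ μ))).and
        (continuousAt_const.eventually_lt (hφ.add continuousAt_const)
          (lt_add_of_pos_right _ (hδ μ)))
  have hM := isMaxTimes_extend M
  let ρ : t → MaxTimes X := fun j =>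
    ⟨fun φ => extend M (P j * evalMap φ), isMaxTimes_comp_evalMap (hM.comp_mul (P j))⟩
  have hρ1 : ∀ j, (ρ j).1 1 = extend M (P j) := fun j => by
    simp only [ρ, evalMap_one, mul_one]
  have hP : ∀ j, extend M (P j) ≤ 1 := fun j => by
    rw [← extend_one M, ← hP1, hM.map_finset_sup]
    exact Finset.le_sup (f := fun j => extend M (P j)) (Finset.mem_univ j)
  have hnorm : ∀ j : t, extend M (P j) ≠ 0 → ∀ Φ ∈ G,
      Φ (toDotMeasure d (ρ j)) < Φ j + ε / 2 ∧ Φ j < Φ (toDotMeasure d (ρ j)) + ε / 2 := by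
    intro j hj
    refine hF j _ fun φ hφ => ?_
    have hp := pos_iff_ne_zero.2 hj
    rw [extend_toDotMeasure d (by rwa [hρ1]), hρ1]
    constructor
    · rw [inv_mul_le_iff₀ hp, mul_comm]
      exact hM.map_mul_le_of_le fun κ hκ => (hP2 j κ hκ φ hφ).1.le
    · rw [← mul_le_mul_iff_left₀ hp, add_mul, mul_right_comm, inv_mul_cancel₀ hj, one_mul]
      exact hM.mul_le_map_mul_add fun κ hκ => (hP2 j κ hκ φ hφ).2.le
  have hloc : ∀ j : t, ∀ Φ ∈ G, (ρ j).1 1 * Φ (toDotMeasure d (ρ j)) ≤ extend M (P j * Φ) + ε ∧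
      extend M (P j * Φ) ≤ (ρ j).1 1 * Φ (toDotMeasure d (ρ j)) + ε := by
    intro j Φ hΦ
    rw [hρ1, mul_comm]
    have hεP : ε * extend M (P j) ≤ ε := mul_le_of_le_one_right zero_le (hP j)
    rcases eq_or_ne (extend M (P j)) 0 with h0 | h0
    -- A piece of mass `0` contributes nothing on either side, so its default point is irrelevant.
    · have := hM.map_mul_le_of_le (P := P j) fun y _ => le_boundOf Φ y
      rw [h0, mul_zero] at this
      exact ⟨by simp [h0], this.trans zero_le⟩
    obtain ⟨h1, h2⟩ := hnorm j h0 Φ hΦ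
    -- Both `κ` and the normalized barycenter are within `ε / 2` of the center `j` as measured by
    -- `Φ`.
    have hfar : ∀ κ, P j κ ≠ 0 → Φ κ ≤ Φ (toDotMeasure d (ρ j)) + ε ∧
        Φ (toDotMeasure d (ρ j)) ≤ Φ κ + ε := fun κ hκ => by
      obtain ⟨h3, h4⟩ := hF j κ (fun φ hφ => ⟨(hP2 j κ hκ φ hφ).1.le,
        (hP2 j κ hκ φ hφ).2.le⟩) Φ hΦ
      rw [← add_halves ε, ← add_assoc, ← add_assoc]
      exact ⟨h3.le.trans (by gcongr), h1.le.trans (by gcongr)⟩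
    refine ⟨(hM.mul_le_map_mul_add fun κ hκ => (hfar κ hκ).2).trans (by gcongr),
      (hM.map_mul_le_of_le fun κ hκ => (hfar κ hκ).1).trans ?_⟩
    rw [add_mul]
    gcongr
  refine ⟨t, ρ, fun φ => ?_, fun Φ hΦ => ?_⟩
  · rw [extend_dotBarycenterMap]
    exact (hM.sup_map_mul hP1 _).symm
  · rw [← hM.sup_map_mul hP1 Φ, combine]
    refine ⟨Finset.sup_le fun j hj => (hloc j Φ hΦ).1.trans ?_,
      Finset.sup_le fun j hj => (hloc j Φ hΦ).2.trans ?_⟩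
    · gcongr
      exact Finset.le_sup (f := fun j => extend M (P j * Φ)) hj
    · gcongr
      exact Finset.le_sup (f := fun j => (ρ j).1 1 * Φ (toDotMeasure d (ρ j))) hj

end Localize

/-! ### Openness of the barycenter map. -/

theorem theorem4p1 (X : Type*) [TopologicalSpace X] [CompactSpace X] [T2Space X] :
    IsOpenMap (dotBarycenterMap X) := by
  refine IsOpenMap.of_nhds_le fun M U hU => ?_
  rw [Filter.mem_map] at hU
  set ν := dotBarycenterMap X M with hν
  -- Half of `ε` pays for replacing `M` by a finite combination, half for replacing `ρ` by weighted
  -- copies of `ν`. The interior is used so that continuity of the section applies at `ν`.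
  obtain ⟨G, ε, hε, hG⟩ := isInducing_extend.exists_finset_forall_le (interior_mem_nhds.2 hU)
  have h2 : 0 < ε / 2 := half_pos hε
  obtain ⟨t, ρ, hρ, hρG⟩ := exists_combine_approx M ν G h2
  have hne : Nonempty t := by
    by_contra h
    rw [not_nonempty_iff] at h
    have h1 := hρ 1
    rw [Finset.univ_eq_empty, Finset.sup_empty, extend_one] at h1
    exact one_ne_zero h1
  have hV : {ρ' : t → MaxTimes X | ∀ Φ ∈ G, combine ν ρ' Φ < combine ν ρ Φ + ε / 2 ∧
      combine ν ρ Φ < combine ν ρ' Φ + ε / 2} ∈ 𝓝 ρ := by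
    refine (Filter.eventually_all_finset G).2 fun Φ _ => ?_
    have hΦ := (continuous_combine (J := t) ν Φ).continuousAt (x := ρ)
    exact (hΦ.eventually_lt continuousAt_const (lt_add_of_pos_right _ h2)).and
      (continuousAt_const.eventually_lt (hΦ.add continuousAt_const) (lt_add_of_pos_right _ h2))
  have hind : IsInducing fun (ρ' : t → MaxTimes X) (p : t × C(X, ℝ≥0)) => (ρ' p.1).1 p.2 := by
    refine .of_comp (g := fun (q : t × C(X, ℝ≥0) → ℝ≥0) j φ => q (j, φ))
      (continuous_pi fun p => (MaxTimes.continuous_apply p.2).comp (continuous_apply p.1))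
      (by fun_prop) ?_
    exact IsInducing.piMap fun _ : t => IsInducing.subtypeVal
  classical
  obtain ⟨F, η, hη, hF⟩ := hind.exists_finset_forall_le hV
  obtain ⟨h, hh, hw⟩ := (isMaxTimes_extend ν).exists_weights (fun j => (ρ j).2) hρ
    (F.image Prod.snd) hη
  have hmem := hF (weighted h ν) fun p hp => hw p.1 p.2 (Finset.mem_image_of_mem _ hp)
  have hsec : barycenterSection hh ν ν ∈ interior (dotBarycenterMap X ⁻¹' U) := by
    refine hG _ fun Φ hΦ => ?_
    rw [extend_barycenterSection]
    obtain ⟨h3, h4⟩ := hmem Φ hΦ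
    obtain ⟨h5, h6⟩ := hρG Φ hΦ
    rw [← add_halves ε, ← add_assoc, ← add_assoc]
    exact ⟨h3.le.trans (by gcongr), h6.trans (by gcongr)⟩
  filter_upwards [(continuous_barycenterSection hh ν).continuousAt.preimage_mem_nhds
    (isOpen_interior.mem_nhds hsec)] with ν' hν'
  simpa only [Set.mem_preimage, dotBarycenterMap_barycenterSection] using interior_subset hν'
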